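/- **Theorem (integral representation of the Lamé polynomial).** Let $a,b,c,q,c_0\in\mathbb C$ with $a\ne b$, $a\ne c$, let $\lambda\in\{0,\tfrac12\}$, and let $\alpha_0\le\alpha_1\le\alpha_2\le\cdots$ be natural numbers. For each $i$ let $\alpha^{(i)}=2(2\alpha_i+i+\lambda)$ or $\alpha^{(i)}=-2(2\alpha_i+i+\lambda)-1$. For $\alpha\in\mathbb C$ put $$A_n(\alpha)=\frac{\frac14(\alpha(\alpha+1)a-q)-(2a-b-c)(n+\lambda)^2}{(a-b)(a-c)(n+1+\lambda)(n+\frac12+\lambda)},\qquad B_n(\alpha)=\frac{[\alpha-(1-2(n+\lambda))][\alpha-2(n-1+\lambda)]}{4(a-b)(a-c)(n+1+\lambda)(n+\frac12+\lambda)},$$ the coefficients of the recurrence $c_{n+1}=A_nc_n+B_nc_{n-1}$ for a solution $\sum_n c_n(x-a)^{n+\lambda}$ of the Lamé equation $$\mathcal L_\alpha y:=y''+\tfrac12\Big(\tfrac1{x-a}+\tfrac1{x-b}+\tfrac1{x-c}\Big)y'+\frac{-\alpha(\alpha+1)x+q}{4(x-a)(x-b)(x-c)}\,y=0 .$$ Let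 $y_m(z)$, $z=x-a$, be the sub-series with exactly $m$ factors $A_n$, in which the parameter has the value $\alpha^{(k)}$ in the factors following the $k$-th factor $A$ up to and including the next one: $$y_m(z)=c_0\sum_{0\le i_0\le i_1\le\cdots\le i_m,\ i_k\le\alpha_k}\ \prod_{k=0}^{m-1}A_{2i_k+k}(\alpha^{(k)})\ \prod_{k=0}^{m}\ \prod_{j=i_{k-1}}^{i_k-1}B_{2j+k+1}(\alpha^{(k)})\ z^{2i_m+m+\lambda}\qquad(i_{-1}:=0).$$ Then the following hold. 1. The $B_n$ terms terminate: $B_{2\alpha_m+m+1}(\alpha^{(m)})=0$ for all $m$. 2. $y=\sum_m y_m$ is a formal solution of the Lamé equation in which the parameter is $\alpha^{(m)}$ on $y_m$: for every $M$, $\sum_{m\le M}\mathcal L_{\alpha^{(m)}}y_m(x-a)=O\big((x-a)^{M+\lambda-1}\big)$ as $x\to a$, $x-a\in\mathbb C\setminus(-\infty,0]$ (principal powers). 3. Let $x\ne a$, $z=x-a$, $\eta=-\frac{(x-a)^2}{(a-b)(a-c)}$, $\mu=-\frac{x-a}{(a-b)(a-c)}$, let $(x)_n$ be the rising factorial, and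 let $$F(w)=\sum_{i=0}^{\alpha_0}\frac{(-\alpha_0)_i(\alpha_0+\frac14+\lambda)_i}{(1+\frac\lambda2)_i(\frac34+\frac\lambda2)_i}\,w^i .$$ Then $y_0(z)=c_0z^\lambda F(\eta)$, and for every $n\ge1$ $$y_n(z)=c_0z^\lambda\mu^n\,\big(K_nK_{n-1}\cdots K_1F\big)(\eta),$$ where, for $1\le l\le n$, $$\begin{aligned}(K_lf)(w)=\int_0^1\!dt\,t^{\frac12(l-\frac52+\lambda)}\int_0^1\!du\,u^{\frac12(l-2+\lambda)}\,\frac1{2\pi i}\oint_{|v|=\rho_l}\frac{dv}{v}\,&\big(1-wv(1-t)(1-u)\big)^{-(l+\frac14+\lambda)}\\ \times\Big(\frac{v-1}{v}\,\frac1{1-wv(1-t)(1-u)}\Big)^{\alpha_l}\,&(D_lf)\Big(\frac{1}{v-1}\,\frac{w\,v\,t\,u}{1-wv(1-t)(1-u)}\Big),\end{aligned}$$ $$D_l=(2a-b-c)\,w^{-s}(w\partial_w)^2w^{s}-a(\alpha_{l-1}+s)(\alpha_{l-1}+s+\tfrac14)+\tfrac q{16},\qquad s=\tfrac12(l-1+\lambda).$$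 In other words, $y_n$ is given by $n$ nested triple integrals over $t_l,u_l\in[0,1]$ and $v_l$, $l=n,\dots,1$, in the variables $$w_{n+1,n}=\eta,\qquad w_{l,n}=\frac1{v_l-1}\,\frac{w_{l+1,n}v_lt_lu_l}{1-w_{l+1,n}v_l(1-t_l)(1-u_l)},$$ the operator of level $l$ being taken in the variable $w_{l,n}$ and the innermost function being $F(w_{1,n})$. The radii are arbitrary subject to $0<\rho_l<1$ and $\rho_lW_{l+1}<1$ for $1\le l\le n$, where $W_{n+1}=|\eta|$ and $W_l=\rho_lW_{l+1}/\big((1-\rho_l)(1-\rho_lW_{l+1})\big)$. Such radii exist. At every level $l$ and every $w\neq0$ with $|w|\le W_{l+1}$, all the integrals and derivatives in $(K_lf)(w)$, with $f=K_{l-1}\cdots K_1F$, exist. 4. Consequently, with admissible radii chosen for each $n$, for every $N$ $$\sum_{m=0}^N y_m(z)=c_0z^\lambda\Big\{F(\eta)+\sum_{n=1}^N (K_n\cdots K_1F)(\eta)\,\mu^n\Big\},$$ that is, the series $y=\sum_m y_m$ and its integral representation agree partial sum by partial sum. -/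

import Mathlib

open scoped Topology Real

noncomputable section

/-- The left-hand side of the algebraic Lamé equation with parameters `α, q` and finite
singularities `a, b, c`, applied to the function `y` at the point `x`. -/
def lameOp (a b c q α : ℂ) (y : ℂ → ℂ) (x : ℂ) : ℂ :=
  deriv (deriv y) x
    + 1 / 2 * (1 / (x - a) + 1 / (x - b) + 1 / (x - c)) * deriv y x
    + (-α * (α + 1) * x + q) / (4 * (x - a) * (x - b) * (x - c)) * y x

/-- The coefficient `A_n` of the recurrence `c_{n+1} = A_n c_n + B_n c_{n-1}` satisfied by a
Frobenius solution `∑ c_n (x - a)^(n + lam)` of the Lamé equation. -/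
def lameA (a b c q lam α : ℂ) (n : ℕ) : ℂ :=
  (1 / 4 * (α * (α + 1) * a - q) - (2 * a - b - c) * (n + lam) ^ 2) /
    ((a - b) * (a - c) * (n + 1 + lam) * (n + 1 / 2 + lam))

/-- The coefficient `B_n` of the same recurrence. -/
def lameB (a b c lam α : ℂ) (n : ℕ) : ℂ :=
  ((α - (1 - 2 * (n + lam))) * (α - 2 * (n - 1 + lam))) /
    (2 ^ 2 * (a - b) * (a - c) * (n + 1 + lam) * (n + 1 / 2 + lam))

/-- The coefficient of `z^(2 i + m + lam)` in the sub-series that contains exactly `m` of the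
`A_n`'s (for `c_0 = 1`): the sum over `i_0 ≤ i_1 ≤ ⋯ ≤ i_m = i` with `i_k ≤ d k` for `k < m` of
`(∏_{j < i_0} B_{2j+1}) A_{2 i_0} (∏_{i_0 ≤ j < i_1} B_{2j+2}) A_{2 i_1 + 1} ⋯
(∏_{i_{m-1} ≤ j < i_m} B_{2j+m+1})`.
In each `B_{2j+k+1}` and each `A_{2 i_k + k}` the parameter of the equation has the value `α k`. -/
def lameSubCoeff (a b c q lam : ℂ) (α : ℕ → ℂ) (d : ℕ → ℕ) : ℕ → ℕ → ℂ
  | 0, i => ∏ j ∈ Finset.range i, lameB a b c lam (α 0) (2 * j + 1)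
  | m + 1, i => ∑ i' ∈ Finset.range (min i (d m) + 1),
      lameSubCoeff a b c q lam α d m i' * lameA a b c q lam (α m) (2 * i' + m) *
        ∏ j ∈ Finset.Ico i' i, lameB a b c lam (α (m + 1)) (2 * j + (m + 2))

/-- The sub-series `y_m(z)`, whose last summation index `i_m` runs from `i_{m-1}` to `d m`. -/
def lameSub (a b c q lam c₀ : ℂ) (α : ℕ → ℂ) (d : ℕ → ℕ) (m : ℕ) (z : ℂ) : ℂ :=
  c₀ * ∑ i ∈ Finset.range (d m + 1),
    lameSubCoeff a b c q lam α d m i * z ^ (2 * (i : ℂ) + m + lam)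

/-- The rising factorial `(x)_n`. -/
def risingFac (x : ℂ) (n : ℕ) : ℂ := (ascPochhammer ℂ n).eval x

/-- The terminating hypergeometric series
`∑_{i ≤ d₀} (-d₀)_i (d₀ + 1/4 + lam)_i / ((1 + lam/2)_i (3/4 + lam/2)_i) w^i`. -/
def lameHyp (lam : ℂ) (d₀ : ℕ) (w : ℂ) : ℂ :=
  ∑ i ∈ Finset.range (d₀ + 1),
    risingFac (-(d₀ : ℂ)) i * risingFac (d₀ + 1 / 4 + lam) i /
      (risingFac (1 + lam / 2) i * risingFac (3 / 4 + lam / 2) i) * w ^ i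

/-- The Euler operator `w ∂_w`. -/
def eulerOp (g : ℂ → ℂ) (w : ℂ) : ℂ := w * deriv g w

/-- The value at `w₀ ≠ 0` of `w^{-s} (w ∂_w)² w^s f`. The value does not depend on the branch of
`w^s` near `w₀`; the branch used is the one that is `1` at `w₀` up to a constant factor
(namely `(w / w₀)^s`), which is analytic near `w₀`. -/
def eulerConj (s : ℂ) (f : ℂ → ℂ) (w₀ : ℂ) : ℂ :=
  eulerOp (eulerOp (fun w => (w / w₀) ^ s * f w)) w₀

/-- The differential operator of level `l ≥ 1`, with `e = α_{l-1}` a natural number. -/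
def lameDiffOp (a b c q lam : ℂ) (e l : ℕ) (f : ℂ → ℂ) (w : ℂ) : ℂ :=
  (2 * a - b - c) * eulerConj (((l : ℂ) - 1 + lam) / 2) f w
    + (-a * (e + ((l : ℂ) - 1 + lam) / 2) * (e + ((l : ℂ) - 1 / 2 + lam) / 2) + q / 2 ^ 4) * f w

/-- One step `w_{l+1,n} ↦ w_{l,n}` of the recursion for the nested variables. -/
def wStep (w t u v : ℂ) : ℂ :=
  1 / (v - 1) * (w * v * t * u / (1 - w * v * (1 - t) * (1 - u)))

/-- The integrand in `v` of level `l ≥ 1`; here `w` stands for `w_{l+1,n}`, and the differential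
operator acts on the function `f` of the variable `w_{l,n}`. -/
def lameKernel (a b c q lam : ℂ) (d : ℕ → ℕ) (l : ℕ) (f : ℂ → ℂ) (w t u v : ℂ) : ℂ :=
  1 / v * (1 - w * v * (1 - t) * (1 - u)) ^ (-((l : ℂ) + 1 / 4 + lam))
    * ((v - 1) / v * (1 / (1 - w * v * (1 - t) * (1 - u)))) ^ (d l)
    * lameDiffOp a b c q lam (d (l - 1)) l f (wStep w t u v)

/-- The integrand in `u` of level `l`, containing the contour integral over `|v| = r`. -/
def lameUIntegrand (a b c q lam : ℂ) (d : ℕ → ℕ) (r : ℝ) (l : ℕ) (f : ℂ → ℂ) (w : ℂ)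
    (t u : ℝ) : ℂ :=
  (u : ℂ) ^ (((l : ℂ) - 2 + lam) / 2) *
    (1 / (2 * π * Complex.I) * ∮ v in C(0, r), lameKernel a b c q lam d l f w t u v)

/-- The integrand in `t` of level `l`. -/
def lameTIntegrand (a b c q lam : ℂ) (d : ℕ → ℕ) (r : ℝ) (l : ℕ) (f : ℂ → ℂ) (w : ℂ)
    (t : ℝ) : ℂ :=
  (t : ℂ) ^ (((l : ℂ) - 5 / 2 + lam) / 2) *
    ∫ u in (0 : ℝ)..1, lameUIntegrand a b c q lam d r l f w t u

/-- The nested triple integrals of the levels `l, l-1, …, 1`, as a function of `w = w_{l+1,n}`,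
the innermost function being the terminating hypergeometric series in `w_{1,n}`. The contour of
level `k` is the circle `|v_k| = ρ k`. -/
def lameNested (a b c q lam : ℂ) (d : ℕ → ℕ) (ρ : ℕ → ℝ) : ℕ → ℂ → ℂ
  | 0, w => lameHyp lam (d 0) w
  | l + 1, w => ∫ t in (0 : ℝ)..1,
      lameTIntegrand a b c q lam d (ρ (l + 1)) (l + 1) (lameNested a b c q lam d ρ l) w t

/-- Existence of the triple integral of level `l` at `w`, and of the derivatives in it. -/
def LevelExists (a b c q lam : ℂ) (d : ℕ → ℕ) (r : ℝ) (l : ℕ) (f : ℂ → ℂ) (w : ℂ) : Prop :=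
  (∀ t ∈ Set.Ioo (0 : ℝ) 1, ∀ u ∈ Set.Ioo (0 : ℝ) 1,
      (∀ v ∈ Metric.sphere (0 : ℂ) r, AnalyticAt ℂ f (wStep w t u v)) ∧
      CircleIntegrable (fun v => lameKernel a b c q lam d l f w t u v) 0 r) ∧
    (∀ t ∈ Set.Ioo (0 : ℝ) 1, IntervalIntegrable
      (fun u => lameUIntegrand a b c q lam d r l f w t u) MeasureTheory.volume 0 1) ∧
    IntervalIntegrable
      (fun t => lameTIntegrand a b c q lam d r l f w t) MeasureTheory.volume 0 1

/-- The circles `|v_l| = ρ l`, `1 ≤ l ≤ n`, are admissible contours for the `n`-fold nested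
integral starting from `w_{n+1,n} = η`: each of them goes once round `0` and leaves outside both
`1` and all the points `1 / (w_{l+1,n} (1 - t_l) (1 - u_l))`. Here `W l` bounds `|w_{l,n}|`. -/
structure AdmissibleRadii (η : ℂ) (n : ℕ) (ρ W : ℕ → ℝ) : Prop where
  start : W (n + 1) = ‖η‖
  pos : ∀ l ∈ Finset.Icc 1 n, 0 < ρ l
  lt_one : ∀ l ∈ Finset.Icc 1 n, ρ l < 1
  mul_lt_one : ∀ l ∈ Finset.Icc 1 n, ρ l * W (l + 1) < 1
  step : ∀ l ∈ Finset.Icc 1 n,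
    W l = ρ l * W (l + 1) / ((1 - ρ l) * (1 - ρ l * W (l + 1)))

end

/-! On the punctured disc where it is needed, every nested integral is a polynomial, so the
representation reduces to comparing coefficients. `lameDiffOp` is diagonal on monomials
(`lameDiffOp_of_eventuallyEq_sum`). Put $D=\alpha_l$ and $X=w(1-t)(1-u)$. After the change of
variable, $w^i$ contributes $(wtu)^i$ times $v^{-(D-i+1)}(v-1)^{D-i}(1-vX)^{-\kappa}$ with
$\kappa=l+\frac14+\lambda+D+i$. Its residue at $0$ is a terminating ${}_2F_1$ in $X$, and the
integrals over $u$ and $t$ turn each $X^k$ into two beta values (`level_integral`).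

Scaling by $-(a-b)(a-c)$ turns $A_n$ into an eigenvalue over two linear factors, and $B_n$ into a
ratio of consecutive hypergeometric coefficients. One level of the integral therefore inserts one
$A$ followed by a chain of $B$'s, which is the recursion defining the sub-series
(`levelCoeff_mul_beta`, `sum_levelIndex`). Induction over the levels gives `lameNested_eq_sum`.

For the formal solution, the recurrence multiplied by the indicial polynomial makes the $B$ terms of
each level telescope, while the $A$ terms of level $m$ cancel against level $m+1$. Only the $A$
terms of the last level survive (`lameOp_lameSub`), and they have high order at $a$. -/

/-! ### Contour integrals of powers of $1-vx$. -/

theorem hasDerivAt_one_sub_mul_cpow {x κ v : ℂ} (h : 1 - v * x ∈ Complex.slitPlane) :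
    HasDerivAt (fun v : ℂ => (1 - v * x) ^ (-κ)) (κ * x * (1 - v * x) ^ (-(κ + 1))) v := by
  have h1 : HasDerivAt (fun v : ℂ => 1 - v * x) (-x) v := by
    simpa using ((hasDerivAt_id v).mul_const x).const_sub 1
  convert h1.cpow_const (c := -κ) h using 1
  rw [show -(κ + 1) = -κ - 1 by ring]
  ring

theorem one_sub_mem_slitPlane {y : ℂ} (h : ‖y‖ < 1) : 1 - y ∈ Complex.slitPlane := by
  rw [sub_eq_add_neg]
  exact Complex.mem_slitPlane_of_norm_lt_one (by simpa using h)

theorem iteratedDeriv_one_sub_mul_cpow (x κ : ℂ) (n : ℕ) {v : ℂ} (hv : ‖v * x‖ < 1) :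
    iteratedDeriv n (fun v : ℂ => (1 - v * x) ^ (-κ)) v =
      (∏ j ∈ Finset.range n, (κ + j)) * x ^ n * (1 - v * x) ^ (-(κ + n)) := by
  induction n generalizing v with
  | zero => simp
  | succ n ih =>
    rw [iteratedDeriv_succ]
    have hopen : ∀ᶠ v' in 𝓝 v, ‖v' * x‖ < 1 :=
      (by fun_prop : Continuous fun v' : ℂ => ‖v' * x‖).continuousAt.eventually_lt_const hv
    have hev : iteratedDeriv n (fun v : ℂ => (1 - v * x) ^ (-κ)) =ᶠ[𝓝 v] fun v =>
        (∏ j ∈ Finset.range n, (κ + j)) * x ^ n * (1 - v * x) ^ (-(κ + n)) :=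
      hopen.mono fun v' hv' => ih hv'
    rw [hev.deriv_eq, ((hasDerivAt_one_sub_mul_cpow (one_sub_mem_slitPlane hv)).const_mul _).deriv,
      Finset.prod_range_succ]
    push_cast
    rw [← add_assoc]
    ring

/-- The Taylor coefficients of `(1 - v x)^(-κ)` at `0` as Cauchy integrals. -/
theorem circleIntegral_one_sub_mul_cpow {x κ : ℂ} {r : ℝ} (hr : 0 < r) (hrx : r * ‖x‖ < 1)
    (n : ℕ) :
    (∮ v in C(0, r), 1 / v ^ (n + 1) * (1 - v * x) ^ (-κ)) =
      2 * π * Complex.I / n.factorial * ((∏ j ∈ Finset.range n, (κ + j)) * x ^ n) := by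
  have hs : ∀ v ∈ Metric.closedBall (0 : ℂ) r, ‖v * x‖ < 1 := fun v hv => by
    rw [norm_mul]
    exact (mul_le_mul_of_nonneg_right (by simpa using hv) (norm_nonneg x)).trans_lt hrx
  have hd : ∀ v ∈ Metric.closedBall (0 : ℂ) r,
      DifferentiableAt ℂ (fun v : ℂ => (1 - v * x) ^ (-κ)) v := fun v hv =>
    (hasDerivAt_one_sub_mul_cpow (one_sub_mem_slitPlane (hs v hv))).differentiableAt
  have := DiffContOnCl.circleIntegral_one_div_sub_center_pow_smul hr n (c := (0 : ℂ))
    (f := fun v : ℂ => (1 - v * x) ^ (-κ))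
    (DifferentiableOn.diffContOnCl fun v hv =>
      (hd v (Metric.closure_ball_subset_closedBall hv)).differentiableWithinAt)
  rw [iteratedDeriv_one_sub_mul_cpow x κ n (by simp)] at this
  simpa using this

theorem circleIntegrable_pow_mul_cpow {x κ : ℂ} {r : ℝ} (hr : 0 < r) (hrx : r * ‖x‖ < 1)
    (m : ℕ) :
    CircleIntegrable (fun v : ℂ => 1 / v ^ (m + 1) * (v - 1) ^ m * (1 - v * x) ^ (-κ)) 0 r := by
  refine ContinuousOn.circleIntegrable hr.le fun v hv => ?_
  have hv' : ‖v‖ = r := by simpa using hv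
  have h0 : v ≠ 0 := norm_pos_iff.mp (by rw [hv']; exact hr)
  have hd : ContinuousAt (fun v : ℂ => (1 - v * x) ^ (-κ)) v :=
    (hasDerivAt_one_sub_mul_cpow
      (one_sub_mem_slitPlane (by rw [norm_mul, hv']; exact hrx))).continuousAt
  refine ContinuousAt.continuousWithinAt (ContinuousAt.mul ?_ hd)
  exact ContinuousAt.mul (ContinuousAt.div (by fun_prop) (by fun_prop) (pow_ne_zero _ h0))
    (by fun_prop)

/-- The contour integral of one monomial: a terminating `₂F₁`. -/
theorem circleIntegral_pow_mul_cpow {x κ : ℂ} {r : ℝ} (hr : 0 < r) (hrx : r * ‖x‖ < 1)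
    (m : ℕ) :
    (∮ v in C(0, r), 1 / v ^ (m + 1) * (v - 1) ^ m * (1 - v * x) ^ (-κ)) =
      2 * π * Complex.I * ∑ k ∈ Finset.range (m + 1),
        (-1) ^ k * m.choose k * (∏ j ∈ Finset.range k, (κ + j)) / k.factorial * x ^ k := by
  have hexp : Set.EqOn (fun v : ℂ => 1 / v ^ (m + 1) * (v - 1) ^ m * (1 - v * x) ^ (-κ))
      (fun v => ∑ k ∈ Finset.range (m + 1),
        ((-1) ^ k * m.choose k) * (1 / v ^ (k + 1) * (1 - v * x) ^ (-κ)))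
      (Metric.sphere 0 r) := by
    intro v hv
    have h0 : v ≠ 0 := norm_pos_iff.mp (by rw [show ‖v‖ = r by simpa using hv]; exact hr)
    simp only
    -- Expanding $(-1+v)^m$ with $k$ counting the factors $-1$ leaves $v^{m-k}/v^{m+1}=v^{-(k+1)}$,
    -- a single Cauchy integral.
    rw [sub_eq_neg_add, add_pow, Finset.mul_sum, Finset.sum_mul]
    refine Finset.sum_congr rfl fun k hk => ?_
    have hk' : k ≤ m := by simpa [Nat.lt_succ_iff] using hk
    obtain ⟨j, rfl⟩ := Nat.exists_eq_add_of_le hk'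
    rw [Nat.add_sub_cancel_left]
    field_simp
    ring
  have hint : ∀ k : ℕ, CircleIntegrable
      (fun v : ℂ => 1 / v ^ (k + 1) * (1 - v * x) ^ (-κ)) 0 r := fun k => by
    refine ContinuousOn.circleIntegrable hr.le fun v hv => ?_
    have hv' : ‖v‖ = r := by simpa using hv
    have h0 : v ≠ 0 := norm_pos_iff.mp (by rw [hv']; exact hr)
    have hd : ContinuousAt (fun v : ℂ => (1 - v * x) ^ (-κ)) v :=
      (hasDerivAt_one_sub_mul_cpow
        (one_sub_mem_slitPlane (by rw [norm_mul, hv']; exact hrx))).continuousAt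
    refine ContinuousAt.continuousWithinAt (ContinuousAt.mul ?_ hd)
    exact ContinuousAt.div (by fun_prop) (by fun_prop) (pow_ne_zero _ h0)
  rw [circleIntegral.integral_congr hr.le hexp, circleIntegral.integral_fun_sum, Finset.mul_sum]
  · refine Finset.sum_congr rfl fun k _ => ?_
    rw [circleIntegral.integral_const_mul, circleIntegral_one_sub_mul_cpow hr hrx]
    ring
  · exact fun k _ => (hint k).const_smul (a := ((-1) ^ k * m.choose k : ℂ))

/-! ### Beta integrals. -/

/-- The endpoints are excluded because splitting a complex power requires a nonzero base; the
integrals do not see them. -/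
theorem cpow_mul_beta_eqOn (e : ℂ) (i k : ℕ) :
    Set.EqOn (fun u : ℝ => (u : ℂ) ^ (e + i + 1 - 1) * (1 - (u : ℂ)) ^ ((k : ℂ) + 1 - 1))
      (fun u : ℝ => (u : ℂ) ^ e * ((u : ℂ) ^ i * (1 - (u : ℂ)) ^ k)) (Set.Ioo 0 1) := by
  intro u hu
  have h0 : (u : ℂ) ≠ 0 := by exact_mod_cast hu.1.ne'
  simp only [add_sub_cancel_right]
  rw [Complex.cpow_add _ _ h0, Complex.cpow_natCast, Complex.cpow_natCast, mul_assoc]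

theorem intervalIntegrable_cpow_mul_beta {e : ℂ} (he : -1 < e.re) (i k : ℕ) :
    IntervalIntegrable (fun u : ℝ => (u : ℂ) ^ e * ((u : ℂ) ^ i * (1 - (u : ℂ)) ^ k))
      MeasureTheory.volume 0 1 := by
  have h : IntervalIntegrable _ MeasureTheory.volume 0 1 :=
    Complex.betaIntegral_convergent (u := e + i + 1) (v := (k : ℂ) + 1)
      (by simp; linarith [i.cast_nonneg (α := ℝ)]) (by simp; positivity)
  refine (intervalIntegrable_congr_uIoo ?_).mp h
  rw [Set.uIoo_of_le zero_le_one]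
  exact cpow_mul_beta_eqOn e i k

theorem integral_cpow_mul_beta {e : ℂ} (he : -1 < e.re) (i k : ℕ) :
    ∫ u in (0 : ℝ)..1, (u : ℂ) ^ e * ((u : ℂ) ^ i * (1 - (u : ℂ)) ^ k) =
      k.factorial / ∏ j ∈ Finset.range (k + 1), (e + i + 1 + j) := by
  rw [← Complex.betaIntegral_eval_nat_add_one_right (u := e + i + 1)
    (by simp; linarith [i.cast_nonneg (α := ℝ)]), Complex.betaIntegral]
  refine (intervalIntegral.integral_congr_uIoo ?_).symm
  rw [Set.uIoo_of_le zero_le_one]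
  exact fun u hu => cpow_mul_beta_eqOn e i k hu

/-! ### The conjugated Euler operator on polynomials. -/

/-- Each $w^{s+i}$ is an eigenfunction of $w\partial_w$ with eigenvalue $i+s$. The result is an
equality of germs so that the operator can be applied a second time. -/
theorem eulerOp_cpow_mul_sum {w₀ : ℂ} (hw₀ : w₀ ≠ 0) (s : ℂ) (c : ℕ → ℂ) (t : Finset ℕ)
    {f : ℂ → ℂ} (hf : f =ᶠ[𝓝 w₀] fun w => ∑ i ∈ t, c i * w ^ i) :
    eulerOp (fun w => (w / w₀) ^ s * f w) =ᶠ[𝓝 w₀]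
      fun w => (w / w₀) ^ s * ∑ i ∈ t, (c i * (i + s)) * w ^ i := by
  have h1 : ∀ᶠ w in 𝓝 w₀, w / w₀ ∈ Complex.slitPlane :=
    (by fun_prop : Continuous fun w : ℂ => w / w₀).continuousAt.eventually_mem
      (Complex.isOpen_slitPlane.mem_nhds (by simp [hw₀]))
  filter_upwards [h1, hf.eventually_nhds, eventually_ne_nhds hw₀] with w hw hfw hw0
  have hc : HasDerivAt (fun w : ℂ => (w / w₀) ^ s) (s * (w / w₀) ^ (s - 1) * (1 / w₀)) w :=
    ((hasDerivAt_id w).div_const w₀).cpow_const hw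
  have hp : HasDerivAt (fun w : ℂ => ∑ i ∈ t, c i * w ^ i)
      (∑ i ∈ t, c i * (i * w ^ (i - 1))) w :=
    HasDerivAt.fun_sum fun i _ => (hasDerivAt_pow i w).const_mul (c i)
  have hg := ((hc.mul hp).congr_of_eventuallyEq
    (f₁ := fun w => (w / w₀) ^ s * f w) (hfw.mono fun w' h => by simp [h])).deriv
  rw [eulerOp, hg, Complex.cpow_sub _ _ (div_ne_zero hw0 hw₀), Complex.cpow_one]
  simp only [mul_add, Finset.mul_sum, ← Finset.sum_add_distrib]
  refine Finset.sum_congr rfl fun i _ => ?_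
  rcases i with _ | i
  · simp
    field_simp
  · simp only [Nat.add_sub_cancel, pow_succ]
    field_simp
    push_cast
    ring

theorem eulerConj_of_eventuallyEq_sum {w₀ : ℂ} (hw₀ : w₀ ≠ 0) (s : ℂ) (c : ℕ → ℂ)
    (t : Finset ℕ) {f : ℂ → ℂ} (hf : f =ᶠ[𝓝 w₀] fun w => ∑ i ∈ t, c i * w ^ i) :
    eulerConj s f w₀ = ∑ i ∈ t, c i * (i + s) ^ 2 * w₀ ^ i := by
  have h1 := eulerOp_cpow_mul_sum hw₀ s c t hf
  have h2 := (eulerOp_cpow_mul_sum hw₀ s (fun i => c i * (i + s)) t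
    (Filter.EventuallyEq.refl _ _)).self_of_nhds
  rw [eulerConj, eulerOp, h1.deriv_eq, ← eulerOp, h2]
  simp only [div_self hw₀]
  rw [Complex.one_cpow, one_mul]
  exact Finset.sum_congr rfl fun i _ => by ring

/-! ### One level of the nested integral. -/

noncomputable section

/-- Serves both real integrations of a level. An index $\tau=(i,k)$ carries the exponents of $u$ and
$1-u$. -/
theorem beta_sum {e : ℂ} (he : -1 < e.re) (T : Finset (Σ _ : ℕ, ℕ)) (G : (Σ _ : ℕ, ℕ) → ℂ)
    {g : ℝ → ℂ} (hg : ∀ u ∈ Set.Ioo (0 : ℝ) 1,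
      g u = (u : ℂ) ^ e * ∑ τ ∈ T, G τ * ((u : ℂ) ^ τ.1 * (1 - (u : ℂ)) ^ τ.2)) :
    IntervalIntegrable g MeasureTheory.volume 0 1 ∧
      ∫ u in (0 : ℝ)..1, g u = ∑ τ ∈ T, G τ *
        (τ.2.factorial / ∏ j ∈ Finset.range (τ.2 + 1), (e + τ.1 + 1 + j)) := by
  have hint : ∀ τ : (Σ _ : ℕ, ℕ), IntervalIntegrable
      (fun u : ℝ => G τ * ((u : ℂ) ^ e * ((u : ℂ) ^ τ.1 * (1 - (u : ℂ)) ^ τ.2)))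
      MeasureTheory.volume 0 1 :=
    fun τ => (intervalIntegrable_cpow_mul_beta he τ.1 τ.2).const_mul _
  have heq : Set.EqOn g
      (fun u => ∑ τ ∈ T, G τ * ((u : ℂ) ^ e * ((u : ℂ) ^ τ.1 * (1 - (u : ℂ)) ^ τ.2)))
      (Set.uIoo 0 1) := by
    intro u hu
    rw [Set.uIoo_of_le zero_le_one] at hu
    rw [hg u hu, Finset.mul_sum]
    exact Finset.sum_congr rfl fun τ _ => by ring
  constructor
  · refine (intervalIntegrable_congr_uIoo heq).mpr ?_
    have := IntervalIntegrable.sum T fun τ _ => hint τ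
    rwa [Finset.sum_fn] at this
  · rw [intervalIntegral.integral_congr_uIoo heq,
      intervalIntegral.integral_finsetSum fun τ _ => hint τ]
    refine Finset.sum_congr rfl fun τ _ => ?_
    rw [intervalIntegral.integral_const_mul, integral_cpow_mul_beta he]

/-- The eigenvalue of the differential operator of level `l` on `w ^ i`. -/
def levelEigenvalue (a b c q lam : ℂ) (e l i : ℕ) : ℂ :=
  (2 * a - b - c) * (i + ((l : ℂ) - 1 + lam) / 2) ^ 2 +
    (-a * (e + ((l : ℂ) - 1 + lam) / 2) * (e + ((l : ℂ) - 1 / 2 + lam) / 2) + q / 2 ^ 4)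

theorem lameDiffOp_of_eventuallyEq_sum (a b c q lam : ℂ) (e l : ℕ) {w : ℂ} (hw : w ≠ 0)
    (p : ℕ → ℂ) (s : Finset ℕ) {f : ℂ → ℂ} (hf : f =ᶠ[𝓝 w] fun w => ∑ i ∈ s, p i * w ^ i) :
    lameDiffOp a b c q lam e l f w =
      ∑ i ∈ s, p i * levelEigenvalue a b c q lam e l i * w ^ i := by
  rw [lameDiffOp, eulerConj_of_eventuallyEq_sum hw _ p s hf, hf.self_of_nhds, Finset.mul_sum,
    Finset.mul_sum, ← Finset.sum_add_distrib]
  exact Finset.sum_congr rfl fun i _ => by rw [levelEigenvalue]; ring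

theorem norm_mul_one_sub_mul_one_sub_le {w : ℂ} {t u : ℝ} (ht : t ∈ Set.Ioo (0 : ℝ) 1)
    (hu : u ∈ Set.Ioo (0 : ℝ) 1) : ‖w * (1 - (t : ℂ)) * (1 - (u : ℂ))‖ ≤ ‖w‖ := by
  have h : ∀ x ∈ Set.Ioo (0 : ℝ) 1, ‖1 - (x : ℂ)‖ ≤ 1 := fun x hx => by
    rw [← Complex.ofReal_one, ← Complex.ofReal_sub, Complex.norm_real, Real.norm_eq_abs, abs_le]
    constructor <;> linarith [hx.1, hx.2]
  rw [norm_mul, norm_mul, mul_assoc]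
  exact mul_le_of_le_one_right (norm_nonneg w)
    (mul_le_one₀ (h t ht) (norm_nonneg _) (h u hu))

/-- The bound is strict because $t,u<1$. The new variable thus lies in an open punctured disc, where
a formula for the inner function may be differentiated. -/
theorem wStep_bound {w v : ℂ} {r : ℝ} {t u : ℝ} (hw : w ≠ 0) (hr0 : 0 < r) (hr1 : r < 1)
    (hrw : r * ‖w‖ < 1) (ht : t ∈ Set.Ioo (0 : ℝ) 1) (hu : u ∈ Set.Ioo (0 : ℝ) 1)
    (hv : ‖v‖ = r) :
    wStep w t u v ≠ 0 ∧ ‖wStep w t u v‖ < r * ‖w‖ / ((1 - r) * (1 - r * ‖w‖)) := by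
  have hX := norm_mul_one_sub_mul_one_sub_le (w := w) ht hu
  have hv0 : v ≠ 0 := norm_pos_iff.mp (hv ▸ hr0)
  have hwv : ‖w * v * (1 - (t : ℂ)) * (1 - (u : ℂ))‖ ≤ r * ‖w‖ := by
    rw [show w * v * (1 - (t : ℂ)) * (1 - (u : ℂ)) = v * (w * (1 - (t : ℂ)) * (1 - (u : ℂ)))
      by ring, norm_mul, hv]
    gcongr
  have h1 : 1 - r ≤ ‖v - 1‖ := by
    have := norm_sub_norm_le (1 : ℂ) v
    rwa [norm_one, hv, norm_sub_rev] at this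
  have h2 : 1 - r * ‖w‖ ≤ ‖1 - w * v * (1 - (t : ℂ)) * (1 - (u : ℂ))‖ := by
    have := norm_sub_norm_le (1 : ℂ) (w * v * (1 - (t : ℂ)) * (1 - (u : ℂ)))
    rw [norm_one] at this
    linarith
  have hr1' : 0 < 1 - r := by linarith
  have hrw' : 0 < 1 - r * ‖w‖ := by linarith
  have ht0 : (t : ℂ) ≠ 0 := by exact_mod_cast ht.1.ne'
  have hu0 : (u : ℂ) ≠ 0 := by exact_mod_cast hu.1.ne'
  have h3 : v - 1 ≠ 0 := norm_pos_iff.mp (hr1'.trans_le h1)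
  have h4 : 1 - w * v * (1 - (t : ℂ)) * (1 - (u : ℂ)) ≠ 0 := norm_pos_iff.mp (hrw'.trans_le h2)
  refine ⟨mul_ne_zero (one_div_ne_zero h3) (div_ne_zero
    (mul_ne_zero (mul_ne_zero (mul_ne_zero hw hv0) ht0) hu0) h4), ?_⟩
  have hnum : ‖w * v * t * u‖ < r * ‖w‖ := by
    rw [norm_mul, norm_mul, norm_mul, hv, Complex.norm_real, Complex.norm_real,
      Real.norm_of_nonneg ht.1.le, Real.norm_of_nonneg hu.1.le, mul_comm ‖w‖ r, mul_assoc]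
    exact mul_lt_of_lt_one_right (mul_pos hr0 (norm_pos_iff.mpr hw))
      (mul_lt_one_of_nonneg_of_lt_one_left ht.1.le ht.2 hu.2.le)
  have hpos : 0 < (1 - r) * (1 - r * ‖w‖) := mul_pos hr1' hrw'
  rw [wStep, norm_mul, norm_div, norm_div, norm_one, div_mul_div_comm, one_mul]
  exact div_lt_div₀ hnum (mul_le_mul h1 h2 hrw'.le (norm_nonneg _)) (by positivity) hpos

/-- The summand of `lameKernel` that comes from a monomial `w ^ i`, simplified. -/
theorem kernel_monomial (w t u v lam : ℂ) (l D i : ℕ) (hi : i ≤ D) (hv0 : v ≠ 0)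
    (hv1 : v - 1 ≠ 0) (hY : 1 - v * (w * (1 - t) * (1 - u)) ≠ 0) :
    1 / v * (1 - w * v * (1 - t) * (1 - u)) ^ (-((l : ℂ) + 1 / 4 + lam))
      * ((v - 1) / v * (1 / (1 - w * v * (1 - t) * (1 - u)))) ^ D
      * (1 / (v - 1) * (w * v * t * u / (1 - w * v * (1 - t) * (1 - u)))) ^ i =
    (w * t * u) ^ i * (1 / v ^ (D - i + 1) * (v - 1) ^ (D - i) *
      (1 - v * (w * (1 - t) * (1 - u))) ^ (-((l : ℂ) + 1 / 4 + lam + D + i))) := by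
  obtain ⟨m, rfl⟩ := Nat.exists_eq_add_of_le hi
  rw [show w * v * (1 - t) * (1 - u) = v * (w * (1 - t) * (1 - u)) by ring,
    Nat.add_sub_cancel_left]
  set Y := 1 - v * (w * (1 - t) * (1 - u)) with hYdef
  -- The kernel supplies $D=i+m$ factors $1/Y$ and the substituted variable supplies $i$ more; all
  -- are absorbed into the exponent of $Y$.
  rw [show -((l : ℂ) + 1 / 4 + lam + (i + m : ℕ) + i) =
    -((l : ℂ) + 1 / 4 + lam) - ((i + m + i : ℕ) : ℂ) by push_cast; ring,
    Complex.cpow_sub _ _ hY, Complex.cpow_natCast]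
  generalize v - 1 = V at hv1 ⊢
  simp only [mul_pow, div_pow, one_div, inv_pow, pow_add]
  field_simp

section level

variable {a b c q lam : ℂ} {d : ℕ → ℕ} {l : ℕ} {f : ℂ → ℂ} {p : ℕ → ℂ} {w : ℂ} {r R : ℝ}

/-- The coefficients of the double expansion of the contour integral of level `l`. -/
def levelCoeff (a b c q lam : ℂ) (d : ℕ → ℕ) (l : ℕ) (p : ℕ → ℂ) (w : ℂ)
    (τ : Σ _ : ℕ, ℕ) : ℂ :=
  p τ.1 * levelEigenvalue a b c q lam (d (l - 1)) l τ.1 *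
    ((-1) ^ τ.2 * (d l - τ.1).choose τ.2 *
      (∏ j ∈ Finset.range τ.2, ((l : ℂ) + 1 / 4 + lam + d l + τ.1 + j)) / τ.2.factorial) *
    w ^ (τ.1 + τ.2)

/-- The index set of the same expansion. -/
def levelIndex (d : ℕ → ℕ) (l : ℕ) : Finset (Σ _ : ℕ, ℕ) :=
  (Finset.range (d (l - 1) + 1)).sigma fun i => Finset.range (d l - i + 1)

theorem lameKernel_eqOn (hd : d (l - 1) ≤ d l) (hw : w ≠ 0) (hr0 : 0 < r) (hr1 : r < 1)
    (hrw : r * ‖w‖ < 1) (hR : r * ‖w‖ / ((1 - r) * (1 - r * ‖w‖)) ≤ R)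
    (hf : ∀ w', w' ≠ 0 → ‖w'‖ < R → f =ᶠ[𝓝 w'] fun w =>
      ∑ i ∈ Finset.range (d (l - 1) + 1), p i * w ^ i)
    {t u : ℝ} (ht : t ∈ Set.Ioo (0 : ℝ) 1) (hu : u ∈ Set.Ioo (0 : ℝ) 1) :
    Set.EqOn (fun v => lameKernel a b c q lam d l f w t u v)
      (fun v => ∑ i ∈ Finset.range (d (l - 1) + 1),
        (p i * levelEigenvalue a b c q lam (d (l - 1)) l i * (w * t * u) ^ i) *
        (1 / v ^ (d l - i + 1) * (v - 1) ^ (d l - i) *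
          (1 - v * (w * (1 - (t : ℂ)) * (1 - (u : ℂ)))) ^
            (-((l : ℂ) + 1 / 4 + lam + d l + i))))
      (Metric.sphere 0 r) := by
  intro v hv
  have hv' : ‖v‖ = r := by simpa using hv
  have hv0 : v ≠ 0 := norm_pos_iff.mp (hv' ▸ hr0)
  have hv1 : v - 1 ≠ 0 := by
    intro h
    rw [sub_eq_zero.mp h, norm_one] at hv'
    exact hr1.ne' hv'
  have hY : 1 - v * (w * (1 - (t : ℂ)) * (1 - (u : ℂ))) ≠ 0 := by
    refine Complex.slitPlane_ne_zero (one_sub_mem_slitPlane ?_)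
    rw [norm_mul, hv']
    exact (mul_le_mul_of_nonneg_left (norm_mul_one_sub_mul_one_sub_le ht hu) hr0.le).trans_lt hrw
  obtain ⟨h0, hlt⟩ := wStep_bound hw hr0 hr1 hrw ht hu hv'
  simp only [lameKernel]
  rw [lameDiffOp_of_eventuallyEq_sum a b c q lam (d (l - 1)) l h0 p _
    (hf _ h0 (hlt.trans_le hR)), Finset.mul_sum]
  refine Finset.sum_congr rfl fun i hi => ?_
  -- Here the monotonicity of `d` enters: the exponent $D-i$ of $v-1$ is nonnegative, so the
  -- binomial expansion terminates.
  have hi' : i ≤ d l := (Nat.lt_succ_iff.mp (Finset.mem_range.mp hi)).trans hd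
  rw [mul_assoc _ ((w * t * u) ^ i), ← kernel_monomial w t u v lam l (d l) i hi' hv0 hv1 hY, wStep]
  ring

theorem norm_contour_lt_one (hr0 : 0 < r) (hrw : r * ‖w‖ < 1)
    {t u : ℝ} (ht : t ∈ Set.Ioo (0 : ℝ) 1) (hu : u ∈ Set.Ioo (0 : ℝ) 1) :
    r * ‖w * (1 - (t : ℂ)) * (1 - (u : ℂ))‖ < 1 :=
  (mul_le_mul_of_nonneg_left (norm_mul_one_sub_mul_one_sub_le ht hu) hr0.le).trans_lt hrw

theorem lameKernel_circleIntegrable (hd : d (l - 1) ≤ d l) (hw : w ≠ 0) (hr0 : 0 < r)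
    (hr1 : r < 1)
    (hrw : r * ‖w‖ < 1) (hR : r * ‖w‖ / ((1 - r) * (1 - r * ‖w‖)) ≤ R)
    (hf : ∀ w', w' ≠ 0 → ‖w'‖ < R → f =ᶠ[𝓝 w'] fun w =>
      ∑ i ∈ Finset.range (d (l - 1) + 1), p i * w ^ i)
    {t u : ℝ} (ht : t ∈ Set.Ioo (0 : ℝ) 1) (hu : u ∈ Set.Ioo (0 : ℝ) 1) :
    CircleIntegrable (fun v => lameKernel a b c q lam d l f w t u v) 0 r := by
  have h : CircleIntegrable (fun v => ∑ i ∈ Finset.range (d (l - 1) + 1),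
        (p i * levelEigenvalue a b c q lam (d (l - 1)) l i * (w * t * u) ^ i) *
        (1 / v ^ (d l - i + 1) * (v - 1) ^ (d l - i) *
          (1 - v * (w * (1 - (t : ℂ)) * (1 - (u : ℂ)))) ^
            (-((l : ℂ) + 1 / 4 + lam + d l + i)))) 0 r :=
    CircleIntegrable.fun_sum _ fun i _ =>
      (circleIntegrable_pow_mul_cpow hr0 (norm_contour_lt_one hr0 hrw ht hu) _).const_smul
  refine (circleIntegrable_congr ?_).mpr h
  rw [abs_of_pos hr0]
  exact lameKernel_eqOn hd hw hr0 hr1 hrw hR hf ht hu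

theorem lameKernel_circleIntegral (hd : d (l - 1) ≤ d l) (hw : w ≠ 0) (hr0 : 0 < r)
    (hr1 : r < 1)
    (hrw : r * ‖w‖ < 1) (hR : r * ‖w‖ / ((1 - r) * (1 - r * ‖w‖)) ≤ R)
    (hf : ∀ w', w' ≠ 0 → ‖w'‖ < R → f =ᶠ[𝓝 w'] fun w =>
      ∑ i ∈ Finset.range (d (l - 1) + 1), p i * w ^ i)
    {t u : ℝ} (ht : t ∈ Set.Ioo (0 : ℝ) 1) (hu : u ∈ Set.Ioo (0 : ℝ) 1) :
    1 / (2 * π * Complex.I) * (∮ v in C(0, r), lameKernel a b c q lam d l f w t u v) =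
      ∑ τ ∈ levelIndex d l, (levelCoeff a b c q lam d l p w τ *
        ((t : ℂ) ^ τ.1 * (1 - (t : ℂ)) ^ τ.2)) * ((u : ℂ) ^ τ.1 * (1 - (u : ℂ)) ^ τ.2) := by
  have hx := norm_contour_lt_one hr0 hrw ht hu
  rw [circleIntegral.integral_congr hr0.le (lameKernel_eqOn hd hw hr0 hr1 hrw hR hf ht hu),
    circleIntegral.integral_fun_sum, Finset.mul_sum, levelIndex, Finset.sum_sigma]
  swap
  · exact fun i _ => (circleIntegrable_pow_mul_cpow hr0 hx _).const_smul
  refine Finset.sum_congr rfl fun i _ => ?_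
  rw [circleIntegral.integral_const_mul, circleIntegral_pow_mul_cpow hr0 hx, Finset.mul_sum,
    Finset.mul_sum, Finset.mul_sum]
  refine Finset.sum_congr rfl fun k _ => ?_
  have hpi : (2 * π * Complex.I : ℂ) ≠ 0 := Complex.two_pi_I_ne_zero
  have hk : (k.factorial : ℂ) ≠ 0 := by exact_mod_cast k.factorial_ne_zero
  simp only [levelCoeff, mul_pow, pow_add]
  field_simp

/-- One level of the nested integral, applied to a polynomial. -/
theorem level_integral (hl : 1 ≤ l) (hlam : lam = 0 ∨ lam = 1 / 2) (hd : d (l - 1) ≤ d l)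
    (hw : w ≠ 0) (hr0 : 0 < r) (hr1 : r < 1)
    (hrw : r * ‖w‖ < 1) (hR : r * ‖w‖ / ((1 - r) * (1 - r * ‖w‖)) ≤ R)
    (hf : ∀ w', w' ≠ 0 → ‖w'‖ < R → f =ᶠ[𝓝 w'] fun w =>
      ∑ i ∈ Finset.range (d (l - 1) + 1), p i * w ^ i) :
    LevelExists a b c q lam d r l f w ∧
      ∫ t in (0 : ℝ)..1, lameTIntegrand a b c q lam d r l f w t =
        ∑ τ ∈ levelIndex d l, levelCoeff a b c q lam d l p w τ *
          (τ.2.factorial / ∏ j ∈ Finset.range (τ.2 + 1),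
            (((l : ℂ) - 2 + lam) / 2 + τ.1 + 1 + j)) *
          (τ.2.factorial / ∏ j ∈ Finset.range (τ.2 + 1),
            (((l : ℂ) - 5 / 2 + lam) / 2 + τ.1 + 1 + j)) := by
  have hl' : (1 : ℝ) ≤ l := by exact_mod_cast hl
  -- The worst case is $l=1$, $\lambda=0$, where the exponents of $u$ and $t$ are $-\frac12$ and
  -- $-\frac34$; both are integrable at $0$.
  have heu : -1 < (((l : ℂ) - 2 + lam) / 2).re := by
    rcases hlam with rfl | rfl <;> norm_num <;> linarith
  have het : -1 < (((l : ℂ) - 5 / 2 + lam) / 2).re := by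
    rcases hlam with rfl | rfl <;> norm_num <;> linarith
  have hu := fun (t : ℝ) (ht : t ∈ Set.Ioo (0 : ℝ) 1) =>
    beta_sum heu (levelIndex d l) (fun τ => levelCoeff a b c q lam d l p w τ *
      ((t : ℂ) ^ τ.1 * (1 - (t : ℂ)) ^ τ.2))
      (g := fun u => lameUIntegrand a b c q lam d r l f w t u) fun u hu => by
        rw [lameUIntegrand, lameKernel_circleIntegral hd hw hr0 hr1 hrw hR hf ht hu]
  have ht := beta_sum het (levelIndex d l) (fun τ => levelCoeff a b c q lam d l p w τ *
      (τ.2.factorial / ∏ j ∈ Finset.range (τ.2 + 1),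
            (((l : ℂ) - 2 + lam) / 2 + τ.1 + 1 + j)))
      (g := fun t => lameTIntegrand a b c q lam d r l f w t) fun t ht => by
        rw [lameTIntegrand, (hu t ht).2]
        congr 1
        exact Finset.sum_congr rfl fun τ _ => by ring
  refine ⟨⟨fun t ht u hu => ⟨fun v hv => ?_, lameKernel_circleIntegrable hd hw hr0 hr1 hrw hR hf
    ht hu⟩, fun t ht => (hu t ht).1, ht.1⟩, ht.2⟩
  obtain ⟨h0, hlt⟩ := wStep_bound hw hr0 hr1 hrw ht hu (by simpa using hv)
  refine AnalyticAt.congr ?_ (hf _ h0 (hlt.trans_le hR)).symm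
  exact Finset.analyticAt_fun_sum _ fun i _ => analyticAt_const.mul (analyticAt_id.pow i)

end level


/-! ### Coefficients of the sub-series and of the integrals. -/

theorem ofReal_add_ne_zero {lam : ℂ} (hlam : lam = 0 ∨ lam = 1 / 2) {x : ℝ} (hx : 0 < x)
    {y : ℂ} (hy : y = x + lam) : y ≠ 0 := by
  rintro rfl
  have := congrArg Complex.re hy
  rcases hlam with rfl | rfl <;> norm_num at this <;> linarith

section coefficients

variable {a b c q lam : ℂ} {d : ℕ → ℕ} {α : ℕ → ℂ}

/-- With $N=n-1+\lambda$ the numerator of $B_n$ is $(\alpha+1+2N)(\alpha-2N)$. The two admissible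
values of the parameter are its two roots at $N=2\alpha_m+m+\lambda$. -/
theorem lameB_eq_zero
    (hα : ∀ i : ℕ, α i = 2 * (2 * (d i : ℂ) + i + lam) ∨
      α i = -2 * (2 * (d i : ℂ) + i + lam) - 1) (m : ℕ) :
    lameB a b c lam (α m) (2 * d m + (m + 1)) = 0 := by
  rw [lameB]
  push_cast
  rcases hα m with h | h <;> rw [h] <;> ring

/-- The parameter enters only through $\alpha(\alpha+1)$, which equals $2\sigma(2\sigma+1)$ with
$\sigma=2\alpha_l+l+\lambda$ for both choices. Dividing numerator and denominator by $4$ produces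
the eigenvalue of level $l+1$. -/
theorem scaled_lameA (hab : a ≠ b) (hac : a ≠ c) (hlam : lam = 0 ∨ lam = 1 / 2)
    (hα : ∀ i : ℕ, α i = 2 * (2 * (d i : ℂ) + i + lam) ∨
      α i = -2 * (2 * (d i : ℂ) + i + lam) - 1) (l i : ℕ) :
    -((a - b) * (a - c)) * lameA a b c q lam (α l) (2 * i + l) =
      levelEigenvalue a b c q lam (d l) (l + 1) i /
        ((i + ((l : ℂ) + 1 + lam) / 2) * (i + ((l : ℂ) + 1 / 2 + lam) / 2)) := by
  have hA : a - b ≠ 0 := sub_ne_zero.mpr hab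
  have hB : a - c ≠ 0 := sub_ne_zero.mpr hac
  have h1 : (2 * (i : ℂ) + l + 1 + lam) ≠ 0 :=
    ofReal_add_ne_zero hlam (x := 2 * i + l + 1) (by positivity) (by push_cast; ring)
  have h2 : (2 * (i : ℂ) + l + 1 / 2 + lam) ≠ 0 :=
    ofReal_add_ne_zero hlam (x := 2 * i + l + 1 / 2) (by positivity) (by push_cast; ring)
  rw [lameA, levelEigenvalue]
  push_cast
  rw [show (i : ℂ) + ((l : ℂ) + 1 + lam) / 2 = (2 * (i : ℂ) + l + 1 + lam) / 2 by ring,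
    show (i : ℂ) + ((l : ℂ) + 1 / 2 + lam) / 2 = (2 * (i : ℂ) + l + 1 / 2 + lam) / 2 by ring,
    mul_div_assoc', div_eq_div_iff
      (mul_ne_zero (mul_ne_zero (mul_ne_zero hA hB) h1) h2)
      (mul_ne_zero (div_ne_zero h1 two_ne_zero) (div_ne_zero h2 two_ne_zero))]
  rcases hα l with h | h <;> rw [h] <;> ring

theorem scaled_lameB (hab : a ≠ b) (hac : a ≠ c) (hlam : lam = 0 ∨ lam = 1 / 2)
    (hα : ∀ i : ℕ, α i = 2 * (2 * (d i : ℂ) + i + lam) ∨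
      α i = -2 * (2 * (d i : ℂ) + i + lam) - 1) (m j : ℕ) :
    -((a - b) * (a - c)) * lameB a b c lam (α m) (2 * j + (m + 1)) =
      (j - d m) * ((m : ℂ) + 1 / 4 + lam + d m + j) /
        ((j + 1 + ((m : ℂ) + lam) / 2) * (j + 3 / 4 + ((m : ℂ) + lam) / 2)) := by
  have hA : a - b ≠ 0 := sub_ne_zero.mpr hab
  have hB : a - c ≠ 0 := sub_ne_zero.mpr hac
  have h1 : (2 * (j : ℂ) + (m + 1) + 1 + lam) ≠ 0 :=
    ofReal_add_ne_zero hlam (x := 2 * j + (m + 1) + 1) (by positivity) (by push_cast; ring)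
  have h2 : (2 * (j : ℂ) + (m + 1) + 1 / 2 + lam) ≠ 0 :=
    ofReal_add_ne_zero hlam (x := 2 * j + (m + 1) + 1 / 2) (by positivity) (by push_cast; ring)
  rw [lameB]
  push_cast
  rw [show (j : ℂ) + 1 + ((m : ℂ) + lam) / 2 = (2 * (j : ℂ) + (m + 1) + 1 + lam) / 2 by ring,
    show (j : ℂ) + 3 / 4 + ((m : ℂ) + lam) / 2 = (2 * (j : ℂ) + (m + 1) + 1 / 2 + lam) / 2 by ring,
    mul_div_assoc', div_eq_div_iff
      (mul_ne_zero (mul_ne_zero (mul_ne_zero (mul_ne_zero (by norm_num) hA) hB) h1) h2)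
      (mul_ne_zero (div_ne_zero h1 two_ne_zero) (div_ne_zero h2 two_ne_zero))]
  rcases hα m with h | h <;> rw [h] <;> ring

theorem neg_one_pow_mul_choose_mul_factorial (m k : ℕ) :
    (-1 : ℂ) ^ k * m.choose k * k.factorial = ∏ j ∈ Finset.range k, ((j : ℂ) - m) := by
  induction k with
  | zero => simp
  | succ k ih =>
    rw [Finset.prod_range_succ, ← ih]
    have h : ((m.choose (k + 1) * (k + 1) : ℕ) : ℂ) = m.choose k * ((m : ℂ) - k) := by
      rw [Nat.choose_succ_right_eq]
      -- Truncated subtraction forces the split; for $k>m$ both sides vanish.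
      rcases le_or_gt k m with hkm | hkm
      · push_cast [hkm]; ring
      · simp [Nat.choose_eq_zero_of_lt hkm]
    rw [Nat.factorial_succ]
    push_cast at h ⊢
    linear_combination (-1 : ℂ) ^ (k + 1) * k.factorial * h

/-- The coefficient of `η ^ i μ ^ l` in the sub-series with exactly `l` factors `A_n`, where
`η = -z² / ((a - b) (a - c))` and `μ = -z / ((a - b) (a - c))`. -/
def scaledCoeff (a b c q lam : ℂ) (α : ℕ → ℂ) (d : ℕ → ℕ) (l i : ℕ) : ℂ :=
  lameSubCoeff a b c q lam α d l i * (-((a - b) * (a - c))) ^ (i + l)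

/-- The $i+l+1$ scaling factors are shared out: $i'+l$ to the previous coefficient, one to $A$, one
to each of the $i-i'$ factors $B$. -/
theorem scaledCoeff_succ (l i : ℕ) :
    scaledCoeff a b c q lam α d (l + 1) i = ∑ i' ∈ Finset.range (min i (d l) + 1),
      scaledCoeff a b c q lam α d l i' *
        (-((a - b) * (a - c)) * lameA a b c q lam (α l) (2 * i' + l)) *
        ∏ j ∈ Finset.Ico i' i,
          (-((a - b) * (a - c)) * lameB a b c lam (α (l + 1)) (2 * j + (l + 1 + 1))) := by
  rw [scaledCoeff, lameSubCoeff, Finset.sum_mul]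
  refine Finset.sum_congr rfl fun i' hi' => ?_
  have hi : i' ≤ i := by
    have := Finset.mem_range.mp hi'
    omega
  obtain ⟨k, rfl⟩ := Nat.exists_eq_add_of_le hi
  rw [scaledCoeff, Finset.prod_mul_distrib, Finset.prod_const, Nat.card_Ico,
    Nat.add_sub_cancel_left]
  ring

/-- Of the two $k!$ from the beta integrals, one cancels the Taylor denominator and the other
completes $(-1)^k\binom{D-i}{k}$ to the Pochhammer symbol $(i-D)_k$. In each beta denominator the
factor $j=0$ belongs to $A$, and the remaining $k$ belong to the $B$'s. -/
theorem levelCoeff_mul_beta (hab : a ≠ b) (hac : a ≠ c) (hlam : lam = 0 ∨ lam = 1 / 2)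
    (hα : ∀ i : ℕ, α i = 2 * (2 * (d i : ℂ) + i + lam) ∨
      α i = -2 * (2 * (d i : ℂ) + i + lam) - 1) (l : ℕ) (p : ℕ → ℂ) (w : ℂ) (i k : ℕ)
    (hi : i ≤ d (l + 1)) :
    levelCoeff a b c q lam d (l + 1) p w ⟨i, k⟩ *
      (k.factorial / ∏ j ∈ Finset.range (k + 1), ((((l + 1 : ℕ) : ℂ) - 2 + lam) / 2 + i + 1 + j)) *
      (k.factorial /
        ∏ j ∈ Finset.range (k + 1), ((((l + 1 : ℕ) : ℂ) - 5 / 2 + lam) / 2 + i + 1 + j)) =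
    p i * (-((a - b) * (a - c)) * lameA a b c q lam (α l) (2 * i + l)) *
      (∏ j ∈ Finset.range k,
        (-((a - b) * (a - c)) * lameB a b c lam (α (l + 1)) (2 * (i + j) + (l + 1 + 1)))) *
      w ^ (i + k) := by
  have hk : (k.factorial : ℂ) ≠ 0 := by exact_mod_cast k.factorial_ne_zero
  have hnum : ∏ j ∈ Finset.range k, (((i + j : ℕ) : ℂ) - d (l + 1)) =
      (-1) ^ k * (d (l + 1) - i).choose k * k.factorial := by
    rw [neg_one_pow_mul_choose_mul_factorial]
    refine Finset.prod_congr rfl fun j _ => ?_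
    push_cast [hi]
    ring
  rw [scaled_lameA hab hac hlam hα, Finset.prod_congr rfl fun j _ =>
    scaled_lameB hab hac hlam hα (l + 1) (i + j), Finset.prod_div_distrib,
    Finset.prod_mul_distrib, Finset.prod_mul_distrib, hnum, Finset.prod_range_succ',
    Finset.prod_range_succ', levelCoeff, Nat.add_sub_cancel]
  have e1 : ∀ j : ℕ, (((l + 1 : ℕ) : ℂ) - 2 + lam) / 2 + i + 1 + (j + 1 : ℕ) =
      (i + j : ℕ) + 1 + (((l + 1 : ℕ) : ℂ) + lam) / 2 := fun j => by push_cast; ring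
  have e2 : ∀ j : ℕ, (((l + 1 : ℕ) : ℂ) - 5 / 2 + lam) / 2 + i + 1 + (j + 1 : ℕ) =
      (i + j : ℕ) + 3 / 4 + (((l + 1 : ℕ) : ℂ) + lam) / 2 := fun j => by push_cast; ring
  have e3 : (((l + 1 : ℕ) : ℂ) - 2 + lam) / 2 + i + 1 + (0 : ℕ) =
    i + ((l : ℂ) + 1 + lam) / 2 := by push_cast; ring
  have e4 : (((l + 1 : ℕ) : ℂ) - 5 / 2 + lam) / 2 + i + 1 + (0 : ℕ) =
    i + ((l : ℂ) + 1 / 2 + lam) / 2 := by push_cast; ring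
  have e5 : ∀ j : ℕ, ((l + 1 : ℕ) : ℂ) + 1 / 4 + lam + d (l + 1) + (i + j : ℕ) =
    ((l + 1 : ℕ) : ℂ) + 1 / 4 + lam + d (l + 1) + i + j := fun j => by push_cast; ring
  simp only [e1, e2, e3, e4, e5]
  set Q1 := ∏ j ∈ Finset.range k, (((i + j : ℕ) : ℂ) + 1 + (((l + 1 : ℕ) : ℂ) + lam) / 2)
  set Q2 := ∏ j ∈ Finset.range k, (((i + j : ℕ) : ℂ) + 3 / 4 + (((l + 1 : ℕ) : ℂ) + lam) / 2)
  simp only [div_eq_mul_inv, mul_inv]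
  field_simp

/-- Both sides are the same double sum: $k=i-i'$ is the length of the last chain of $B$'s. -/
theorem sum_levelIndex (hab : a ≠ b) (hac : a ≠ c) (hlam : lam = 0 ∨ lam = 1 / 2)
    (hd : Monotone d)
    (hα : ∀ i : ℕ, α i = 2 * (2 * (d i : ℂ) + i + lam) ∨
      α i = -2 * (2 * (d i : ℂ) + i + lam) - 1) (l : ℕ) (w : ℂ) :
    ∑ τ ∈ levelIndex d (l + 1),
      levelCoeff a b c q lam d (l + 1) (scaledCoeff a b c q lam α d l) w τ *
      (τ.2.factorial / ∏ j ∈ Finset.range (τ.2 + 1),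
        ((((l + 1 : ℕ) : ℂ) - 2 + lam) / 2 + τ.1 + 1 + j)) *
      (τ.2.factorial / ∏ j ∈ Finset.range (τ.2 + 1),
        ((((l + 1 : ℕ) : ℂ) - 5 / 2 + lam) / 2 + τ.1 + 1 + j)) =
    ∑ i ∈ Finset.range (d (l + 1) + 1), scaledCoeff a b c q lam α d (l + 1) i * w ^ i := by
  have hdl : d l ≤ d (l + 1) := hd (Nat.le_succ l)
  simp only [scaledCoeff_succ, Finset.sum_mul]
  symm
  rw [Finset.sum_comm' (t' := Finset.range (d l + 1))
    (s' := fun i' => Finset.Ico i' (d (l + 1) + 1)) (by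
      intro x y
      simp only [Finset.mem_range, Finset.mem_Ico]
      omega), levelIndex, Finset.sum_sigma]
  refine Finset.sum_congr rfl fun i hi => ?_
  have hi' : i ≤ d (l + 1) := (Nat.lt_succ_iff.mp (Finset.mem_range.mp hi)).trans hdl
  rw [Finset.sum_Ico_eq_sum_range, Nat.sub_add_comm hi']
  refine Finset.sum_congr rfl fun k _ => ?_
  rw [levelCoeff_mul_beta hab hac hlam hα l _ w i k hi', Finset.prod_Ico_eq_prod_range,
    Nat.add_sub_cancel_left]

theorem lameHyp_eq_sum (hab : a ≠ b) (hac : a ≠ c) (hlam : lam = 0 ∨ lam = 1 / 2)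
    (hα : ∀ i : ℕ, α i = 2 * (2 * (d i : ℂ) + i + lam) ∨
      α i = -2 * (2 * (d i : ℂ) + i + lam) - 1) (w : ℂ) :
    lameHyp lam (d 0) w =
      ∑ i ∈ Finset.range (d 0 + 1), scaledCoeff a b c q lam α d 0 i * w ^ i := by
  have hrf : ∀ (x : ℂ) (n : ℕ), risingFac x n = ∏ j ∈ Finset.range n, (x + j) := by
    intro x n
    induction n with
    | zero => simp [risingFac]
    | succ n ih => rw [Finset.prod_range_succ, ← ih, risingFac, risingFac, ascPochhammer_succ_eval]
  refine Finset.sum_congr rfl fun i _ => ?_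
  congr 1
  have hpow : (-((a - b) * (a - c))) ^ i = ∏ _j ∈ Finset.range i, -((a - b) * (a - c)) := by
    simp
  rw [scaledCoeff, lameSubCoeff, add_zero, mul_comm (Finset.prod _ _), hpow, ← Finset.prod_mul_distrib,
    Finset.prod_congr rfl fun j _ => scaled_lameB hab hac hlam hα 0 j, Finset.prod_div_distrib,
    Finset.prod_mul_distrib, Finset.prod_mul_distrib, hrf, hrf, hrf, hrf]
  congr 2 <;> refine Finset.prod_congr rfl fun j _ => ?_ <;> push_cast <;> ring

theorem lameSub_eq (hab : a ≠ b) (hac : a ≠ c) (c₀ : ℂ) (m : ℕ) {z η μ : ℂ} (hz : z ≠ 0)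
    (hη : η = -z ^ 2 / ((a - b) * (a - c))) (hμ : μ = -z / ((a - b) * (a - c))) :
    lameSub a b c q lam c₀ α d m z = c₀ * z ^ lam *
      ((∑ i ∈ Finset.range (d m + 1), scaledCoeff a b c q lam α d m i * η ^ i) * μ ^ m) := by
  have hA : a - b ≠ 0 := sub_ne_zero.mpr hab
  have hB : a - c ≠ 0 := sub_ne_zero.mpr hac
  have hη' : -((a - b) * (a - c)) * η = z ^ 2 := by rw [hη]; field_simp
  have hμm : z ^ m = (-((a - b) * (a - c))) ^ m * μ ^ m := by
    rw [← mul_pow, show -((a - b) * (a - c)) * μ = z by rw [hμ]; field_simp]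
  rw [lameSub, mul_assoc c₀]
  congr 1
  rw [Finset.sum_mul, Finset.mul_sum]
  refine Finset.sum_congr rfl fun i _ => ?_
  rw [show 2 * (i : ℂ) + m + lam = lam + (2 * i + m : ℕ) by push_cast; ring,
    Complex.cpow_add _ _ hz, Complex.cpow_natCast, pow_add, pow_mul, scaledCoeff, pow_add,
    ← hη', mul_pow, hμm]
  ring

end coefficients

/-! ### Admissible contours. -/

section radii

variable {η : ℂ} {n : ℕ} {ρ W : ℕ → ℝ}

/-- The map $x\mapsto\rho x/((1-\rho)(1-\rho x))$ is increasing on $0\le x<1/\rho$, so the bound at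
$W_{l+1}$ covers all smaller $|w|$. -/
theorem AdmissibleRadii.contour (h : AdmissibleRadii η n ρ W) {l : ℕ} (hl : l ∈ Finset.Icc 1 n)
    {w : ℂ} (hw : ‖w‖ ≤ W (l + 1)) :
    ρ l * ‖w‖ < 1 ∧ ρ l * ‖w‖ / ((1 - ρ l) * (1 - ρ l * ‖w‖)) ≤ W l := by
  have h0 := h.pos l hl
  have h1 := h.lt_one l hl
  have h2 := h.mul_lt_one l hl
  have h3 : ρ l * ‖w‖ ≤ ρ l * W (l + 1) := mul_le_mul_of_nonneg_left hw h0.le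
  refine ⟨h3.trans_lt h2, ?_⟩
  rw [h.step l hl]
  refine div_le_div₀ ((by positivity : 0 ≤ ρ l * ‖w‖).trans h3) h3
    (mul_pos (by linarith) (by linarith)) ?_
  exact mul_le_mul_of_nonneg_left (by linarith) (by linarith)

theorem exists_admissibleRadii (η : ℂ) (n : ℕ) : ∃ ρ W : ℕ → ℝ, AdmissibleRadii η n ρ W := by
  -- For $x\ge0$ this choice keeps both $R(x)$ and $R(x)\,x$ at most $\frac12$. The sequence `g`
  -- runs from the outermost level inwards, so it is read backwards as $W_l=g_{n+1-l}$.
  set R : ℝ → ℝ := fun x => 1 / (2 * (1 + x)) with hR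
  set g : ℕ → ℝ := fun k => Nat.rec ‖η‖
    (fun _ x => R x * x / ((1 - R x) * (1 - R x * x))) k with hg
  have hRx : ∀ x : ℝ, 0 ≤ x → 0 < R x ∧ R x < 1 ∧ R x * x < 1 := fun x hx => by
    refine ⟨by positivity, ?_, ?_⟩
    · rw [hR]
      simp only
      rw [div_lt_one (by positivity)]
      linarith
    · rw [hR]
      simp only
      rw [div_mul_eq_mul_div, div_lt_one (by positivity)]
      linarith
  have hg0 : ∀ k, 0 ≤ g k := fun k => by
    induction k with
    | zero => exact norm_nonneg η
    | succ k ih =>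
      obtain ⟨h0, h1, h2⟩ := hRx _ ih
      exact div_nonneg (mul_nonneg h0.le ih) (mul_nonneg (by linarith) (by linarith))
  refine ⟨fun l => R (g (n - l)), fun l => g (n + 1 - l), by simp [hg], fun l _ => (hRx _ (hg0 _)).1,
    fun l _ => (hRx _ (hg0 _)).2.1, fun l _ => ?_, fun l hl => ?_⟩
  · simpa only [Nat.add_sub_add_right] using (hRx _ (hg0 (n - l))).2.2
  · simp only [Nat.add_sub_add_right, Nat.sub_add_comm (Finset.mem_Icc.mp hl).2]
    rfl

end radii

/-! ### The nested integrals as polynomials. -/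

section nested

variable {a b c q lam : ℂ} {d : ℕ → ℕ} {α : ℕ → ℂ} {η : ℂ} {n : ℕ} {ρ W : ℕ → ℝ}

theorem eventuallyEq_of_forall_norm_lt {f g : ℂ → ℂ} {R : ℝ}
    (h : ∀ w, w ≠ 0 → ‖w‖ < R → f w = g w) :
    ∀ w, w ≠ 0 → ‖w‖ < R → f =ᶠ[𝓝 w] g := by
  intro w hw hwR
  filter_upwards [eventually_ne_nhds hw, continuous_norm.continuousAt.eventually_lt_const hwR]
    with w' h1 h2 using h w' h1 h2

/-- The inner polynomial formula on the closed punctured disc gives germs on its interior. That is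
where the contour of the next level sends its variable, so `level_integral` applies inductively. -/
theorem lameNested_eq_sum (hab : a ≠ b) (hac : a ≠ c) (hlam : lam = 0 ∨ lam = 1 / 2)
    (hd : Monotone d)
    (hα : ∀ i : ℕ, α i = 2 * (2 * (d i : ℂ) + i + lam) ∨
      α i = -2 * (2 * (d i : ℂ) + i + lam) - 1) (h : AdmissibleRadii η n ρ W)
    {l : ℕ} (hl : l ≤ n) {w : ℂ} (hw : w ≠ 0) (hwW : ‖w‖ ≤ W (l + 1)) :
    lameNested a b c q lam d ρ l w =
      ∑ i ∈ Finset.range (d l + 1), scaledCoeff a b c q lam α d l i * w ^ i := by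
  induction l generalizing w with
  | zero => exact lameHyp_eq_sum hab hac hlam hα w
  | succ l ih =>
    have hm : l + 1 ∈ Finset.Icc 1 n := Finset.mem_Icc.mpr ⟨Nat.le_add_left 1 l, hl⟩
    obtain ⟨h1, h2⟩ := h.contour hm hwW
    rw [lameNested, (level_integral (l := l + 1) (p := scaledCoeff a b c q lam α d l)
      (Nat.le_add_left 1 l) hlam (hd (Nat.le_succ l)) hw (h.pos _ hm) (h.lt_one _ hm) h1 h2
      (eventuallyEq_of_forall_norm_lt fun w' h0 hlt => ih (by omega) h0 hlt.le)).2]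
    exact sum_levelIndex hab hac hlam hd hα l w

theorem lameNested_levelExists (hab : a ≠ b) (hac : a ≠ c) (hlam : lam = 0 ∨ lam = 1 / 2)
    (hd : Monotone d)
    (hα : ∀ i : ℕ, α i = 2 * (2 * (d i : ℂ) + i + lam) ∨
      α i = -2 * (2 * (d i : ℂ) + i + lam) - 1) (h : AdmissibleRadii η n ρ W)
    {l : ℕ} (hm : l ∈ Finset.Icc 1 n) {w : ℂ} (hw : w ≠ 0) (hwW : ‖w‖ ≤ W (l + 1)) :
    LevelExists a b c q lam d (ρ l) l (lameNested a b c q lam d ρ (l - 1)) w := by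
  obtain ⟨h1, h2⟩ := h.contour hm hwW
  obtain ⟨hl1, hln⟩ := Finset.mem_Icc.mp hm
  refine (level_integral (p := scaledCoeff a b c q lam α d (l - 1))
    hl1 hlam (hd (Nat.sub_le l 1)) hw (h.pos _ hm) (h.lt_one _ hm) h1 h2
    (eventuallyEq_of_forall_norm_lt fun w' h0 hlt =>
      lameNested_eq_sum hab hac hlam hd hα h (by omega) h0 ?_)).1
  rw [Nat.sub_add_cancel hl1]
  exact hlt.le

end nested


/-! ### The formal solution. -/

theorem hasDerivAt_sum_sub_cpow {ι : Type*} (s : Finset ι) (k e : ι → ℂ) {a x : ℂ}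
    (hx : x - a ∈ Complex.slitPlane) :
    HasDerivAt (fun x => ∑ i ∈ s, k i * (x - a) ^ e i)
      (∑ i ∈ s, k i * e i * (x - a) ^ (e i - 1)) x := by
  refine HasDerivAt.fun_sum fun i _ => ?_
  have h : HasDerivAt (fun x : ℂ => (x - a) ^ e i) (e i * (x - a) ^ (e i - 1) * 1) x :=
    ((hasDerivAt_id x).sub_const a).cpow_const hx
  simpa [mul_assoc] using h.const_mul (k i)

theorem deriv_sum_sub_cpow {ι : Type*} (s : Finset ι) (k e : ι → ℂ) {a x : ℂ}
    (hx : x - a ∈ Complex.slitPlane) :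
    deriv (fun x => ∑ i ∈ s, k i * (x - a) ^ e i) =ᶠ[𝓝 x]
      fun x => ∑ i ∈ s, k i * e i * (x - a) ^ (e i - 1) := by
  have h : ∀ᶠ x' in 𝓝 x, x' - a ∈ Complex.slitPlane :=
    (by fun_prop : Continuous fun x' : ℂ => x' - a).continuousAt.eventually_mem
      (Complex.isOpen_slitPlane.mem_nhds hx)
  exact h.mono fun x' hx' => (hasDerivAt_sum_sub_cpow s k e hx').deriv

/-- The indicial polynomial of the Lamé equation at `a`, evaluated at the exponent `n + lam`. -/
def lameIndicial (a b c lam : ℂ) (n : ℕ) : ℂ :=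
  (a - b) * (a - c) * (n + lam) * (n - 1 / 2 + lam)

section formal

variable {a b c q lam : ℂ} {d : ℕ → ℕ} {α : ℕ → ℂ}

theorem lameIndicial_mul_lameA (hab : a ≠ b) (hac : a ≠ c) (hlam : lam = 0 ∨ lam = 1 / 2)
    (α : ℂ) (n : ℕ) :
    lameIndicial a b c lam (n + 1) * lameA a b c q lam α n =
      1 / 4 * (α * (α + 1) * a - q) - (2 * a - b - c) * (n + lam) ^ 2 := by
  have hA : a - b ≠ 0 := sub_ne_zero.mpr hab
  have hB : a - c ≠ 0 := sub_ne_zero.mpr hac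
  have h1 : ((n : ℂ) + 1 + lam) ≠ 0 :=
    ofReal_add_ne_zero hlam (x := n + 1) (by positivity) (by push_cast; ring)
  have h2 : ((n : ℂ) + 1 / 2 + lam) ≠ 0 :=
    ofReal_add_ne_zero hlam (x := n + 1 / 2) (by positivity) (by push_cast; ring)
  rw [lameIndicial, lameA, mul_div_assoc',
    div_eq_iff (mul_ne_zero (mul_ne_zero (mul_ne_zero hA hB) h1) h2)]
  push_cast
  ring

theorem lameIndicial_mul_lameB (hab : a ≠ b) (hac : a ≠ c) (hlam : lam = 0 ∨ lam = 1 / 2)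
    (α : ℂ) (n : ℕ) :
    lameIndicial a b c lam (n + 2) * lameB a b c lam α (n + 1) =
      1 / 4 * (α * (α + 1)) - (n + lam) * (n + lam + 1 / 2) := by
  have hA : a - b ≠ 0 := sub_ne_zero.mpr hab
  have hB : a - c ≠ 0 := sub_ne_zero.mpr hac
  have h1 : (((n + 1 : ℕ) : ℂ) + 1 + lam) ≠ 0 :=
    ofReal_add_ne_zero hlam (x := n + 1 + 1) (by positivity) (by push_cast; ring)
  have h2 : (((n + 1 : ℕ) : ℂ) + 1 / 2 + lam) ≠ 0 :=
    ofReal_add_ne_zero hlam (x := n + 1 + 1 / 2) (by positivity) (by push_cast; ring)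
  rw [lameIndicial, lameB, mul_div_assoc',
    div_eq_iff (mul_ne_zero (mul_ne_zero (mul_ne_zero (mul_ne_zero (by norm_num) hA) hB) h1) h2)]
  push_cast
  ring

/-- The Lamé operator applied to a finite Frobenius sum. -/
theorem lameOp_frobenius (hab : a ≠ b) (hac : a ≠ c) (hlam : lam = 0 ∨ lam = 1 / 2)
    (α c₀ : ℂ) (s : Finset ℕ) (k : ℕ → ℂ) (m : ℕ) {x : ℂ}
    (hx : x - a ∈ Complex.slitPlane) (hxb : x - b ≠ 0) (hxc : x - c ≠ 0) :
    (x - a) * (x - b) * (x - c) * lameOp a b c q α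
      (fun x' => c₀ * ∑ i ∈ s, k i * (x' - a) ^ (2 * (i : ℂ) + m + lam)) x =
    c₀ * (x - a) ^ (lam - 1) * ∑ i ∈ s, k i *
      (lameIndicial a b c lam (2 * i + m) * (x - a) ^ (2 * i + m)
        - lameIndicial a b c lam (2 * i + m + 1) * lameA a b c q lam α (2 * i + m)
          * (x - a) ^ (2 * i + m + 1)
        - lameIndicial a b c lam (2 * i + m + 2) * lameB a b c lam α (2 * i + m + 1)
          * (x - a) ^ (2 * i + m + 2)) := by
  have hxa : x - a ≠ 0 := Complex.slitPlane_ne_zero hx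
  have h1 := deriv_sum_sub_cpow s (fun i => c₀ * k i) (fun i => 2 * (i : ℂ) + m + lam) hx
  have h2 := (deriv_sum_sub_cpow s (fun i => c₀ * k i * (2 * (i : ℂ) + m + lam))
    (fun i => 2 * (i : ℂ) + m + lam - 1) hx).self_of_nhds
  have hfun : (fun x' => c₀ * ∑ i ∈ s, k i * (x' - a) ^ (2 * (i : ℂ) + m + lam)) =
      fun x' => ∑ i ∈ s, c₀ * k i * (x' - a) ^ (2 * (i : ℂ) + m + lam) := by
    funext x'
    rw [Finset.mul_sum]
    exact Finset.sum_congr rfl fun i _ => (mul_assoc _ _ _).symm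
  rw [hfun, lameOp, h1.deriv_eq, h2, h1.self_of_nhds]
  simp only [Finset.mul_sum, ← Finset.sum_add_distrib]
  refine Finset.sum_congr rfl fun i _ => ?_
  -- Writing every exponent as $\lambda-1$ plus an integer leaves one common complex power; the rest
  -- is a rational identity.
  rw [lameIndicial_mul_lameA hab hac hlam, lameIndicial_mul_lameB hab hac hlam, lameIndicial,
    show 2 * (i : ℂ) + m + lam - 1 - 1 = (lam - 1) + (2 * i + m : ℕ) - 1 by push_cast; ring,
    show 2 * (i : ℂ) + m + lam - 1 = (lam - 1) + (2 * i + m : ℕ) by push_cast; ring,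
    show 2 * (i : ℂ) + m + lam = (lam - 1) + (2 * i + m : ℕ) + 1 by push_cast; ring,
    Complex.cpow_sub _ _ hxa, Complex.cpow_add _ 1 hxa, Complex.cpow_add _ _ hxa,
    Complex.cpow_natCast, Complex.cpow_one, pow_succ (x - a) (2 * i + m), pow_add (x - a) (2 * i + m) 2]
  generalize (x - a) ^ (lam - 1) = P
  generalize (x - a) ^ (2 * i + m) = Z
  field_simp
  push_cast
  ring

/-- A product ending at index $i+1$ has either a $B$ or an $A$ as its last factor. The second case
needs $i_m=i+1\le\alpha_m$. -/
theorem lameSubCoeff_succ_succ (m i : ℕ) :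
    lameSubCoeff a b c q lam α d (m + 1) (i + 1) =
      lameSubCoeff a b c q lam α d (m + 1) i * lameB a b c lam (α (m + 1)) (2 * i + (m + 2)) +
      if i + 1 ≤ d m then
        lameSubCoeff a b c q lam α d m (i + 1) * lameA a b c q lam (α m) (2 * (i + 1) + m)
      else 0 := by
  have hprod : ∀ i' ≤ i, ∏ j ∈ Finset.Ico i' (i + 1),
      lameB a b c lam (α (m + 1)) (2 * j + (m + 2)) =
      (∏ j ∈ Finset.Ico i' i, lameB a b c lam (α (m + 1)) (2 * j + (m + 2))) *
        lameB a b c lam (α (m + 1)) (2 * i + (m + 2)) :=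
    fun i' hi' => Finset.prod_Ico_succ_top hi' _
  rw [lameSubCoeff, lameSubCoeff, Finset.sum_mul]
  split_ifs with h
  · rw [min_eq_left h, min_eq_left (by omega : i ≤ d m), Finset.sum_range_succ _ (i + 1),
      Finset.Ico_self, Finset.prod_empty, mul_one]
    congr 1
    refine Finset.sum_congr rfl fun i' hi' => ?_
    rw [hprod i' (Nat.lt_succ_iff.mp (Finset.mem_range.mp hi')), mul_assoc, mul_assoc, mul_assoc]
  · rw [min_eq_right (by omega : d m ≤ i + 1), min_eq_right (by omega : d m ≤ i), add_zero]
    refine Finset.sum_congr rfl fun i' hi' => ?_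
    rw [hprod i' (by have := Finset.mem_range.mp hi'; omega), mul_assoc, mul_assoc, mul_assoc]

/-- The contribution of the last `A_n` that is left over by the truncation at level `m`. -/
def lameDefect (a b c q lam : ℂ) (α : ℕ → ℂ) (d : ℕ → ℕ) (m : ℕ) (z : ℂ) : ℂ :=
  ∑ i ∈ Finset.range (d m + 1), lameSubCoeff a b c q lam α d m i *
    (lameIndicial a b c lam (2 * i + m + 1) * lameA a b c q lam (α m) (2 * i + m)
      * z ^ (2 * i + m + 1))

/-- The terms of the Lamé operator without `A_n`, summed over the sub-series of level `m`. -/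
theorem sum_lameSubCoeff_telescope
    (hα : ∀ i : ℕ, α i = 2 * (2 * (d i : ℂ) + i + lam) ∨
      α i = -2 * (2 * (d i : ℂ) + i + lam) - 1) (m : ℕ) (z : ℂ) :
    ∑ i ∈ Finset.range (d m + 1), lameSubCoeff a b c q lam α d m i *
      (lameIndicial a b c lam (2 * i + m) * z ^ (2 * i + m)
        - lameIndicial a b c lam (2 * i + m + 2) * lameB a b c lam (α m) (2 * i + m + 1)
          * z ^ (2 * i + m + 2)) =
    lameSubCoeff a b c q lam α d m 0 * (lameIndicial a b c lam m * z ^ m) +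
    ∑ i ∈ Finset.range (d m), (lameSubCoeff a b c q lam α d m (i + 1) -
      lameSubCoeff a b c q lam α d m i * lameB a b c lam (α m) (2 * i + (m + 1))) *
      (lameIndicial a b c lam (2 * (i + 1) + m) * z ^ (2 * (i + 1) + m)) := by
  simp only [mul_sub, Finset.sum_sub_distrib]
  -- The shift $i\mapsto i+1$ aligns the two sums. The unmatched top term vanishes by
  -- `lameB_eq_zero`, and the unmatched bottom term remains.
  rw [Finset.sum_range_succ', Finset.sum_range_succ _ (d m), add_assoc (2 * d m) m 1,
    lameB_eq_zero hα, mul_zero, mul_zero, zero_mul, mul_zero, add_zero, Nat.zero_add,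
    add_sub_right_comm, add_comm, ← Finset.sum_sub_distrib]
  congr 1
  refine Finset.sum_congr rfl fun i _ => ?_
  rw [show 2 * i + m + 2 = 2 * (i + 1) + m by ring, add_assoc (2 * i) m 1]
  ring

/-- By `lameSubCoeff_succ_succ`, what the telescoped sum of level $m+1$ retains is the defect of
level $m$, so only the defect of level $M$ is left. -/
theorem lameOp_lameSub (hab : a ≠ b) (hac : a ≠ c) (hlam : lam = 0 ∨ lam = 1 / 2)
    (hd : Monotone d)
    (hα : ∀ i : ℕ, α i = 2 * (2 * (d i : ℂ) + i + lam) ∨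
      α i = -2 * (2 * (d i : ℂ) + i + lam) - 1) (c₀ : ℂ) (M : ℕ) {x : ℂ}
    (hx : x - a ∈ Complex.slitPlane) (hxb : x - b ≠ 0) (hxc : x - c ≠ 0) :
    (x - a) * (x - b) * (x - c) * ∑ m ∈ Finset.range (M + 1),
        lameOp a b c q (α m) (fun x' => lameSub a b c q lam c₀ α d m (x' - a)) x =
      -(c₀ * (x - a) ^ (lam - 1) * lameDefect a b c q lam α d M (x - a)) := by
  have key : ∀ m, (x - a) * (x - b) * (x - c) *
      lameOp a b c q (α m) (fun x' => lameSub a b c q lam c₀ α d m (x' - a)) x =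
      c₀ * (x - a) ^ (lam - 1) *
        ((∑ i ∈ Finset.range (d m + 1), lameSubCoeff a b c q lam α d m i *
          (lameIndicial a b c lam (2 * i + m) * (x - a) ^ (2 * i + m)
            - lameIndicial a b c lam (2 * i + m + 2) * lameB a b c lam (α m) (2 * i + m + 1)
              * (x - a) ^ (2 * i + m + 2))) - lameDefect a b c q lam α d m (x - a)) := fun m => by
    simp only [lameSub]
    rw [lameOp_frobenius hab hac hlam (α m) c₀ _ _ m hx hxb hxc, lameDefect,
      ← Finset.sum_sub_distrib]
    congr 1
    exact Finset.sum_congr rfl fun i _ => by ring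
  induction M with
  | zero =>
    -- The values $0$ and $\frac12$ of $\lambda$ are the roots of the indicial equation.
    have h0 : lameIndicial a b c lam 0 = 0 := by
      rw [lameIndicial]
      rcases hlam with rfl | rfl <;> norm_num
    rw [Finset.sum_range_one, key, sum_lameSubCoeff_telescope hα, h0, Finset.sum_eq_zero]
    · ring
    · intro i _
      rw [lameSubCoeff, lameSubCoeff, Finset.prod_range_succ]
      ring
  | succ m ih =>
    rw [Finset.sum_range_succ, mul_add, ih, key, sum_lameSubCoeff_telescope hα]
    have hdm : d m + 1 ≤ d (m + 1) + 1 := Nat.succ_le_succ (hd (Nat.le_succ m))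
    -- Monotonicity of `d` lets the defect be padded with zeros to the range of level $m+1$.
    have hS : lameDefect a b c q lam α d m (x - a) =
        ∑ i ∈ Finset.range (d (m + 1) + 1), (if i ≤ d m then
          lameSubCoeff a b c q lam α d m i * lameA a b c q lam (α m) (2 * i + m) else 0) *
          (lameIndicial a b c lam (2 * i + (m + 1)) * (x - a) ^ (2 * i + (m + 1))) := by
      rw [lameDefect, ← Finset.sum_subset (Finset.range_mono hdm)]
      · refine Finset.sum_congr rfl fun i hi => ?_
        rw [if_pos (Nat.lt_succ_iff.mp (Finset.mem_range.mp hi)), add_assoc (2 * i) m 1]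
        ring
      · intro i _ hi
        rw [if_neg (by simpa [Nat.lt_succ_iff] using hi), zero_mul]
    have h00 : lameSubCoeff a b c q lam α d (m + 1) 0 =
        lameSubCoeff a b c q lam α d m 0 * lameA a b c q lam (α m) m := by
      simp [lameSubCoeff]
    rw [hS, Finset.sum_range_succ', h00, if_pos (Nat.zero_le _)]
    simp only [lameSubCoeff_succ_succ, add_sub_cancel_left, Nat.mul_zero, Nat.zero_add]
    ring_nf

/-- The defect has a factor $(x-a)^{M+1}$, the prefactor is $(x-a)^{\lambda-1}$, and clearing
denominators costs one power of $x-a$. The remaining factor is continuous at $a$. -/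
theorem lameOp_lameSub_isBigO (hab : a ≠ b) (hac : a ≠ c) (hlam : lam = 0 ∨ lam = 1 / 2)
    (hd : Monotone d)
    (hα : ∀ i : ℕ, α i = 2 * (2 * (d i : ℂ) + i + lam) ∨
      α i = -2 * (2 * (d i : ℂ) + i + lam) - 1) (c₀ : ℂ) (M : ℕ) :
    (fun x => ∑ m ∈ Finset.range (M + 1),
        lameOp a b c q (α m) (fun x' => lameSub a b c q lam c₀ α d m (x' - a)) x)
      =O[𝓝[{x | x - a ∈ Complex.slitPlane}] a] (fun x => (x - a) ^ ((M : ℂ) + lam - 1)) := by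
  set Q : ℂ → ℂ := fun x => ∑ i ∈ Finset.range (d M + 1), lameSubCoeff a b c q lam α d M i *
    (lameIndicial a b c lam (2 * i + M + 1) * lameA a b c q lam (α M) (2 * i + M)
      * (x - a) ^ (2 * i)) with hQ
  have hA : a - b ≠ 0 := sub_ne_zero.mpr hab
  have hB : a - c ≠ 0 := sub_ne_zero.mpr hac
  have hcont : ContinuousAt (fun x => -(c₀ * Q x) / ((x - b) * (x - c))) a :=
    ContinuousAt.div (by fun_prop) (by fun_prop) (mul_ne_zero hA hB)
  have hO := (Asymptotics.isBigO_refl (fun x => (x - a) ^ ((M : ℂ) + lam - 1))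
    (𝓝[{x | x - a ∈ Complex.slitPlane}] a)).mul
    ((hcont.tendsto.isBigO_one ℂ).mono nhdsWithin_le_nhds)
  simp only [mul_one] at hO
  refine hO.congr' ?_ Filter.EventuallyEq.rfl
  filter_upwards [self_mem_nhdsWithin,
    nhdsWithin_le_nhds (eventually_ne_nhds hab), nhdsWithin_le_nhds (eventually_ne_nhds hac)]
    with x hx hxb hxc
  have hxb' : x - b ≠ 0 := sub_ne_zero.mpr hxb
  have hxc' : x - c ≠ 0 := sub_ne_zero.mpr hxc
  have hxa : x - a ≠ 0 := Complex.slitPlane_ne_zero hx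
  have hdef : lameDefect a b c q lam α d M (x - a) = (x - a) ^ (M + 1) * Q x := by
    rw [lameDefect, hQ, Finset.mul_sum]
    exact Finset.sum_congr rfl fun i _ => by ring
  refine mul_left_cancel₀ (mul_ne_zero (mul_ne_zero hxa hxb') hxc') ?_
  rw [lameOp_lameSub hab hac hlam hd hα c₀ M hx hxb' hxc', hdef,
    show (M : ℂ) + lam - 1 = lam - 1 + M by ring, Complex.cpow_add _ _ hxa, Complex.cpow_natCast]
  field_simp
  ring

end formal

end

/-! ### Assembly. -/

theorem mainTheorem1 (a b c q c₀ lam : ℂ) (hab : a ≠ b) (hac : a ≠ c)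
    (hlam : lam = 0 ∨ lam = 1 / 2)
    (d : ℕ → ℕ) (hd : Monotone d)
    (α : ℕ → ℂ)
    (hα : ∀ i : ℕ, α i = 2 * (2 * (d i : ℂ) + i + lam) ∨
      α i = -2 * (2 * (d i : ℂ) + i + lam) - 1) :
    -- the `B_n` terms terminate
    (∀ m : ℕ, lameB a b c lam (α m) (2 * d m + (m + 1)) = 0) ∧
    -- `∑ y_m` is a formal solution of the Lamé equation, in which the parameter has the
    -- value `α m` on the sub-series `y_m`
    (∀ M : ℕ,
      (fun x => ∑ m ∈ Finset.range (M + 1),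
        lameOp a b c q (α m) (fun x' => lameSub a b c q lam c₀ α d m (x' - a)) x)
      =O[𝓝[{x | x - a ∈ Complex.slitPlane}] a] (fun x => (x - a) ^ ((M : ℂ) + lam - 1))) ∧
    -- the integral representation
    ∀ x z η μ : ℂ, x ≠ a → z = x - a → η = -(x - a) ^ 2 / ((a - b) * (a - c)) →
      μ = -(x - a) / ((a - b) * (a - c)) →
      lameSub a b c q lam c₀ α d 0 z = c₀ * z ^ lam * lameHyp lam (d 0) η ∧
      (∀ n : ℕ, 1 ≤ n →
        (∃ ρ W : ℕ → ℝ, AdmissibleRadii η n ρ W) ∧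
        ∀ ρ W : ℕ → ℝ, AdmissibleRadii η n ρ W →
          (∀ l ∈ Finset.Icc 1 n, ∀ w : ℂ, w ≠ 0 → ‖w‖ ≤ W (l + 1) →
            LevelExists a b c q lam d (ρ l) l (lameNested a b c q lam d ρ (l - 1)) w) ∧
          lameSub a b c q lam c₀ α d n z =
            c₀ * z ^ lam * (lameNested a b c q lam d ρ n η * μ ^ n)) ∧
      ∀ ρ W : ℕ → ℕ → ℝ, (∀ n : ℕ, 1 ≤ n → AdmissibleRadii η n (ρ n) (W n)) →
        ∀ N : ℕ, ∑ m ∈ Finset.range (N + 1), lameSub a b c q lam c₀ α d m z =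
          c₀ * z ^ lam * (lameHyp lam (d 0) η +
            ∑ n ∈ Finset.Icc 1 N, lameNested a b c q lam d (ρ n) n η * μ ^ n) := by
  refine ⟨lameB_eq_zero hα, lameOp_lameSub_isBigO hab hac hlam hd hα c₀, ?_⟩
  intro x z η μ hx hz hη hμ
  have hz0 : z ≠ 0 := hz ▸ sub_ne_zero.mpr hx
  rw [← hz] at hη hμ
  have hη0 : η ≠ 0 := by
    rw [hη]
    exact div_ne_zero (neg_ne_zero.mpr (pow_ne_zero 2 hz0))
      (mul_ne_zero (sub_ne_zero.mpr hab) (sub_ne_zero.mpr hac))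
  have h0 : lameSub a b c q lam c₀ α d 0 z = c₀ * z ^ lam * lameHyp lam (d 0) η := by
    rw [lameSub_eq hab hac c₀ 0 hz0 hη hμ, pow_zero, mul_one, ← lameHyp_eq_sum hab hac hlam hα]
  have hrep : ∀ (n : ℕ) (ρ W : ℕ → ℝ), AdmissibleRadii η n ρ W →
      lameSub a b c q lam c₀ α d n z =
        c₀ * z ^ lam * (lameNested a b c q lam d ρ n η * μ ^ n) := fun n ρ W h => by
    rw [lameSub_eq hab hac c₀ n hz0 hη hμ,
      -- At the outermost level the variable is $\eta$, which lies on the boundary $|w|=W_{n+1}$;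
      -- hence the closed disc in `lameNested_eq_sum`.
      lameNested_eq_sum hab hac hlam hd hα h le_rfl hη0 h.start.ge]
  refine ⟨h0, fun n _ => ⟨exists_admissibleRadii η n, fun ρ W h =>
    ⟨fun l hl w hw hwW => lameNested_levelExists hab hac hlam hd hα h hl hw hwW,
      hrep n ρ W h⟩⟩, fun ρ W h N => ?_⟩
  rw [Finset.sum_range_succ', h0, add_comm, mul_add, Finset.mul_sum, ← Nat.Ico_zero_eq_range,
    Finset.sum_Ico_add' (fun m => lameSub a b c q lam c₀ α d m z) 0 N 1, zero_add]
  congr 1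
  refine Finset.sum_congr rfl fun n hn => ?_
  exact hrep n _ _ (h n (Finset.mem_Ico.mp hn).1)
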